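/- **Setting.** Let $\mathcal A$ be a finite alphabet with $d\ge 2$ symbols, $\pi=(\pi_0,\pi_1)$ an irreducible pair of bijections $\mathcal A\to\{1,\dots,d\}$ and $\lambda\in\mathbb R_{>0}^{\mathcal A}$ with $\sum_\alpha\lambda_\alpha=1$. Let $T_0=(\pi,\lambda):[0,1)\to[0,1)$ be the corresponding interval exchange transformation, which exchanges the left-closed, right-open intervals $I_\alpha$ of lengths $\lambda_\alpha$, ordered by $\pi_0$ before and by $\pi_1$ after the exchange. Write $T^{(n)}=\mathcal R^n(T_0)$ for the orbit of $T_0$ under (non-normalized) Rauzy–Veech induction $\mathcal R$; for a datum $S$ let $A(S)=\mathrm{Id}+E_{\text{winner},\text{loser}}$ and, for $n\ge m\ge0$, let $A^{T}_{m,n}=A(T^{(n-1)})^{T}\cdots A(T^{(m)})^{T}$. Let $B^T_{0,n}$ be the Zorich cocycle, that is, the product of the same matrices over $n$ steps of the Zorich acceleration of $\mathcal R$ (which groups together the maximal runs of Rauzy–Veech steps of equal type). $T_0$ is *Oseledets generic* if for every $v\in\mathbb R^{\mathcal A}\setminus\{0\}$ the Lyapunov exponent $\theta(v)=\lim_{n\to\infty}\frac1n\log|B^T_{0,n}v|_1\in\mathbb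 R$ exists, and $E_{cs}(T_0)$ is the set consisting of $0$ and the vectors with $\theta(v)\le 0$. $T_0$ satisfies the *Bounded Central (BC) condition* if it satisfies Keane's condition, it is Oseledets generic, every symbol of $\mathcal A$ is the winner of infinitely many Rauzy–Veech steps, and there is a strictly increasing sequence $(n_k)_{k\in\mathbb N}$ of natural numbers such that 1. there are $N\in\mathbb N$ and $K>0$ with $1\le (A^T_{n_k,n_k+N})_{\alpha\beta}\le K$ for all $\alpha,\beta\in\mathcal A$ and all $k$; 2. there is $V>0$ with $\big\|A^T_{0,n_k}|_{E_{cs}(T_0)}\big\|\le V$ for all $k$. For $\omega\in\mathbb R^{\mathcal A}$ let $f_{T_0,\omega}:[0,1)\to\mathbb R$ be equal to $\omega_\alpha$ on $I_\alpha$. For $f:[0,1)\to\mathbb R$ let $S^{T_0}_nf=\sum_{j=0}^{n-1}f\circ T_0^j$ if $n\ge 0$ and $S^{T_0}_nf=-\sum_{j=n}^{-1}f\circ T_0^j$ if $n<0$. **Corollary.** Let $T_0$ satisfy the BC condition and let $\omega\in E_{cs}(T_0)$. Then for every $x\in[0,1)$ there is a sequence of integers $(m_k)_{k\in\mathbb Z}$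 with $m_k\to+\infty$ as $k\to+\infty$ and $m_k\to-\infty$ as $k\to-\infty$ (in particular $|m_k|\to\infty$ as $|k|\to\infty$) such that $$\sup_{k\in\mathbb Z}\big|S^{T_0}_{m_k}f_{T_0,\omega}(x)\big|<+\infty .$$ -/

import Mathlib

open Filter Topology

namespace IntervalExchange

/-- The raw datum `(π, λ)` of an interval exchange with finite alphabet `𝒜`: the two bijections
`π₀ = row 0`, `π₁ = row 1` from `𝒜` to the positions `{0, …, d - 1}`, `d = #𝒜`, giving the order of
the intervals before and after the exchange, and the vector of lengths. -/
structure Datum (𝒜 : Type*) [Fintype 𝒜] where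
  row : Fin 2 → 𝒜 ≃ Fin (Fintype.card 𝒜)
  len : 𝒜 → ℝ

/-- The permutation of the positions that moves the last position to the place right after `p` and
shifts by one the positions strictly between `p` and the last one. -/
def moveLast {d : ℕ} (p : Fin d) : Equiv.Perm (Fin d) where
  toFun r := if hr : r ≤ p then r else if h : (r : ℕ) + 1 < d then ⟨r + 1, h⟩
    else ⟨p + 1, by have := r.2; rw [Fin.le_def] at hr; omega⟩
  invFun s := if s ≤ p then s else if (s : ℕ) = p + 1 then ⟨d - 1, by have := s.2; omega⟩
    else ⟨s - 1, by have := s.2; omega⟩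
  left_inv r := by
    have h1 := r.2
    have h2 := p.2
    ext
    simp only [Fin.le_def]
    by_cases hr : (r : ℕ) ≤ p
    · simp [hr]
    · by_cases h : (r : ℕ) + 1 < d
      · have e1 : ¬ (r : ℕ) + 1 ≤ p := by omega
        have e2 : (r : ℕ) ≠ p := by omega
        simp [hr, h, e1, e2]
      · simp [hr, h]
        omega
  right_inv s := by
    have h1 := s.2
    have h2 := p.2
    ext
    simp only [Fin.le_def]
    by_cases hs : (s : ℕ) ≤ p
    · simp [hs]
    · by_cases h : (s : ℕ) = p + 1
      · have e1 : ¬ d - 1 ≤ (p : ℕ) := by omega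
        have e2 : ¬ d - 1 + 1 < d := by omega
        simp [h, e1, e2]
      · have e1 : ¬ (s : ℕ) - 1 ≤ p := by omega
        have e2 : (s : ℕ) - 1 + 1 < d := by omega
        simp [hs, h, e1, e2]
        omega

namespace Datum

section Intervals

variable {𝒜 : Type*} [Fintype 𝒜]

/-- Left endpoint of the interval labelled `α`, before (`ε = 0`) or after (`ε = 1`) the exchange. -/
def leftEnd (T : Datum 𝒜) (ε : Fin 2) (α : 𝒜) : ℝ :=
  ∑ β with T.row ε β < T.row ε α, T.len β

/-- The interval labelled `α`, before (`ε = 0`) or after (`ε = 1`) the exchange. -/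
def interval (T : Datum 𝒜) (ε : Fin 2) (α : 𝒜) : Set ℝ :=
  Set.Ico (T.leftEnd ε α) (T.leftEnd ε α + T.len α)

/-- The function which takes the constant value `w α` on the exchanged interval `I_α`
(and the value `0` outside all of these intervals). -/
noncomputable def piecewiseConst (T : Datum 𝒜) (w : 𝒜 → ℝ) (x : ℝ) : ℝ :=
  ∑ α, (T.interval 0 α).indicator (fun _ => w α) x

/-- The interval exchange map: it translates `I_α` by the difference between the left endpoints of
the interval labelled `α` after and before the exchange (and is the identity elsewhere). -/
noncomputable def exchange (T : Datum 𝒜) (x : ℝ) : ℝ :=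
  x + T.piecewiseConst (fun α => T.leftEnd 1 α - T.leftEnd 0 α) x

/-- The datum with the two rows exchanged. -/
def flip (T : Datum 𝒜) : Datum 𝒜 where
  row ε := T.row (1 - ε)
  len := T.len

/-- Irreducibility: `π₁ ∘ π₀⁻¹ {1, …, k} = {1, …, k}` only for `k = d`. -/
def Irreducible (T : Datum 𝒜) : Prop :=
  ∀ k : ℕ, 1 ≤ k → k ≤ Fintype.card 𝒜 →
    (fun j => T.row 1 ((T.row 0).symm j)) '' {j : Fin _ | (j : ℕ) < k} =
      {j : Fin _ | (j : ℕ) < k} →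
    k = Fintype.card 𝒜

theorem leftEnd_add_len_le (T : Datum 𝒜) (hT : ∀ α, 0 < T.len α) (ε : Fin 2) {α β : 𝒜}
    (h : T.row ε α < T.row ε β) : T.leftEnd ε α + T.len α ≤ T.leftEnd ε β := by
  classical
  unfold leftEnd
  rw [add_comm, ← Finset.sum_insert (by simp)]
  refine Finset.sum_le_sum_of_subset_of_nonneg ?_ (fun i _ _ => (hT i).le)
  intro γ hγ
  simp only [Finset.mem_insert, Finset.mem_filter, Finset.mem_univ, true_and] at hγ ⊢
  rcases hγ with rfl | hγ
  · exact h
  · exact hγ.trans h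

theorem eq_of_mem_interval (T : Datum 𝒜) (hT : ∀ α, 0 < T.len α) {ε : Fin 2} {α β : 𝒜} {x : ℝ}
    (hα : x ∈ T.interval ε α) (hβ : x ∈ T.interval ε β) : α = β := by
  rcases lt_trichotomy (T.row ε α) (T.row ε β) with h | h | h
  · have := T.leftEnd_add_len_le hT ε h
    exact absurd hα.2 (not_lt.2 (this.trans hβ.1))
  · exact (T.row ε).injective h
  · have := T.leftEnd_add_len_le hT ε h
    exact absurd hβ.2 (not_lt.2 (this.trans hα.1))

theorem exists_mem_interval_iff (T : Datum 𝒜) (hT : ∀ α, 0 < T.len α) (ε : Fin 2) (x : ℝ) :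
    (∃ α, x ∈ T.interval ε α) ↔ 0 ≤ x ∧ x < ∑ α, T.len α := by
  classical
  constructor
  · rintro ⟨α, h1, h2⟩
    refine ⟨le_trans (Finset.sum_nonneg fun i _ => (hT i).le) h1, h2.trans_le ?_⟩
    unfold leftEnd
    rw [add_comm, ← Finset.sum_insert (by simp)]
    exact Finset.sum_le_sum_of_subset_of_nonneg (Finset.subset_univ _) (fun i _ _ => (hT i).le)
  · rintro ⟨h0, h1⟩
    have key : ∀ k : ℕ, k ≤ Fintype.card 𝒜 →
        x < ∑ β with (T.row ε β : ℕ) < k, T.len β → ∃ α, x ∈ T.interval ε α := by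
      intro k
      induction k with
      | zero => intro _ h; simp at h; linarith
      | succ k ih =>
        intro hk h
        by_cases h' : x < ∑ β with (T.row ε β : ℕ) < k, T.len β
        · exact ih (by omega) h'
        · refine ⟨(T.row ε).symm ⟨k, by omega⟩, ?_, ?_⟩
          · simpa [leftEnd, Fin.lt_def] using h'
          · refine h.trans_le (le_of_eq ?_)
            unfold leftEnd
            rw [add_comm _ (T.len _), ← Finset.sum_insert (by simp)]
            refine Finset.sum_congr ?_ (fun _ _ => rfl)
            ext β
            simp only [Finset.mem_insert, Finset.mem_filter, Finset.mem_univ, true_and,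
              Equiv.eq_symm_apply, Equiv.apply_symm_apply, Fin.lt_def, Fin.ext_iff]
            omega
    exact key _ le_rfl (by simpa using h1)

theorem piecewiseConst_of_mem (T : Datum 𝒜) (hT : ∀ α, 0 < T.len α) (w : 𝒜 → ℝ) {α : 𝒜} {x : ℝ}
    (hx : x ∈ T.interval 0 α) : T.piecewiseConst w x = w α := by
  unfold piecewiseConst
  rw [Finset.sum_eq_single α, Set.indicator_of_mem hx]
  · intro β _ hβ
    exact Set.indicator_of_notMem (fun h => hβ (T.eq_of_mem_interval hT h hx)) _
  · simp

theorem exchange_of_mem (T : Datum 𝒜) (hT : ∀ α, 0 < T.len α) {α : 𝒜} {x : ℝ}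
    (hx : x ∈ T.interval 0 α) : T.exchange x = x + (T.leftEnd 1 α - T.leftEnd 0 α) := by
  rw [exchange, T.piecewiseConst_of_mem hT _ hx]

theorem exchange_of_notMem (T : Datum 𝒜) {x : ℝ} (hx : ¬ ∃ α, x ∈ T.interval 0 α) :
    T.exchange x = x := by
  push Not at hx
  simp [exchange, piecewiseConst, hx]

theorem flip_exchange_exchange (T : Datum 𝒜) (hT : ∀ α, 0 < T.len α) (x : ℝ) :
    T.flip.exchange (T.exchange x) = x := by
  by_cases hx : ∃ α, x ∈ T.interval 0 α
  · obtain ⟨α, hα⟩ := hx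
    have h1 : T.exchange x = x + (T.leftEnd 1 α - T.leftEnd 0 α) := T.exchange_of_mem hT hα
    have h2 : T.exchange x ∈ T.flip.interval 0 α := by
      rw [h1]
      change _ ∈ Set.Ico (T.leftEnd 1 α) (T.leftEnd 1 α + T.len α)
      obtain ⟨ha, hb⟩ := hα
      constructor <;> linarith
    rw [T.flip.exchange_of_mem hT h2, h1]
    change _ + (T.leftEnd 0 α - T.leftEnd 1 α) = x
    ring
  · rw [T.exchange_of_notMem hx]
    refine T.flip.exchange_of_notMem ?_
    rw [T.exists_mem_interval_iff hT] at hx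
    rw [T.flip.exists_mem_interval_iff hT]
    exact hx

end Intervals

section Induction

variable {𝒜 : Type*} [Fintype 𝒜] [DecidableEq 𝒜] [Nontrivial 𝒜]

/-- `α_ε = π_ε⁻¹(d)`, the symbol in the last position of the row `ε`. -/
def lastSymbol (T : Datum 𝒜) (ε : Fin 2) : 𝒜 :=
  (T.row ε).symm ⟨Fintype.card 𝒜 - 1, Nat.sub_lt Fintype.card_pos Nat.one_pos⟩

/-- The type: `0` if the last interval before the exchange is longer than the last interval after
the exchange, and `1` otherwise. -/
noncomputable def type (T : Datum 𝒜) : Fin 2 :=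
  if T.len (T.lastSymbol 1) < T.len (T.lastSymbol 0) then 0 else 1

/-- The winner symbol `α_ε`, `ε` the type. -/
noncomputable def winner (T : Datum 𝒜) : 𝒜 := T.lastSymbol T.type

/-- The loser symbol `α_{1 - ε}`, `ε` the type. -/
noncomputable def loser (T : Datum 𝒜) : 𝒜 := T.lastSymbol (1 - T.type)

/-- One step of (non-normalized) Rauzy-Veech induction: the length of the loser is subtracted from
that of the winner, and in the row where the loser is last, it is moved right after the winner. -/
noncomputable def rauzyVeech (T : Datum 𝒜) : Datum 𝒜 where
  row := Function.update T.row (1 - T.type)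
    ((T.row (1 - T.type)).trans (moveLast (T.row (1 - T.type) T.winner)))
  len := Function.update T.len T.winner (T.len T.winner - T.len T.loser)

/-- The matrix `A(π, λ) = Id + E_{winner, loser}`. -/
noncomputable def rauzyMatrix (T : Datum 𝒜) : Matrix 𝒜 𝒜 ℝ :=
  1 + Matrix.single T.winner T.loser 1

/-- `cocycleProd F φ x m k = φ_{m, m + k}(x) = φ(F^{m+k-1} x) ⋯ φ(F^m x)`. -/
def cocycleProd {X M : Type*} [Monoid M] (F : X → X) (φ : X → M) (x : X) (m : ℕ) : ℕ → M
  | 0 => 1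
  | k + 1 => φ (F^[m + k] x) * cocycleProd F φ x m k

/-- The incidence matrix `A^T_{m, m + k}` of Rauzy-Veech induction between the steps `m` and
`m + k`, so that the return times satisfy `q^{(m + k)} = A^T_{m, m + k} q^{(m)}`. -/
noncomputable def incidence (T : Datum 𝒜) (m k : ℕ) : Matrix 𝒜 𝒜 ℝ :=
  cocycleProd rauzyVeech (fun S => S.rauzyMatrix.transpose) T m k

/-- The largest `z` such that the first `z` terms of the orbit under Rauzy-Veech induction
have the same type. -/
noncomputable def zorichTime (T : Datum 𝒜) : ℕ :=
  sSup {z : ℕ | ∀ i < z, (rauzyVeech^[i] T).type = T.type}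

/-- The (non-normalized) Zorich map. -/
noncomputable def zorich (T : Datum 𝒜) : Datum 𝒜 := rauzyVeech^[T.zorichTime] T

/-- The transpose `B^T` of `B(T) = A(T) A(RV T) ⋯ A(RV^{z-1} T)`, `z` the Zorich time. -/
noncomputable def zorichMatrixT (T : Datum 𝒜) : Matrix 𝒜 𝒜 ℝ := T.incidence 0 T.zorichTime

/-- The Zorich (height) cocycle `B^T_{0, n}`. -/
noncomputable def zorichCocycle (T : Datum 𝒜) (n : ℕ) : Matrix 𝒜 𝒜 ℝ :=
  cocycleProd zorich zorichMatrixT T 0 n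

/-- `θ` is the Lyapunov exponent of the vector `v` for the Zorich cocycle:
`θ = lim_n log |B^T_{0, n} v|₁ / n`. -/
def HasLyapunovExponent (T : Datum 𝒜) (v : 𝒜 → ℝ) (θ : ℝ) : Prop :=
  Tendsto (fun n : ℕ => Real.log (∑ α, |(T.zorichCocycle n).mulVec v α|) / n) atTop (𝓝 θ)

/-- Oseledets genericity: every nonzero vector has a Lyapunov exponent. -/
def OseledetsGeneric (T : Datum 𝒜) : Prop :=
  ∀ v : 𝒜 → ℝ, v ≠ 0 → ∃ θ : ℝ, T.HasLyapunovExponent v θ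

/-- The central-stable space `E_cs`: the zero vector and the vectors whose Lyapunov exponent for
the Zorich cocycle is non-positive. -/
def centralStable (T : Datum 𝒜) : Set (𝒜 → ℝ) :=
  {v | v = 0 ∨ ∃ θ ≤ 0, T.HasLyapunovExponent v θ}

/-- The combinatorial rotation number is `∞`-complete: every symbol is the winner infinitely many
times. -/
def InftyComplete (T : Datum 𝒜) : Prop :=
  ∀ α : 𝒜, ∃ᶠ n : ℕ in atTop, (rauzyVeech^[n] T).winner = α

end Induction

end Datum

/-- A normalized irreducible interval exchange transformation `(π, λ)`, on `[0, 1)`. -/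
structure IET (𝒜 : Type*) [Fintype 𝒜] extends Datum 𝒜 where
  irreducible : toDatum.Irreducible
  len_pos : ∀ α, 0 < len α
  len_sum : ∑ α, len α = 1

namespace IET

variable {𝒜 : Type*} [Fintype 𝒜]

/-- The interval exchange transformation of `[0, 1)` as a bijection; it is extended by the identity
to the rest of the real line. -/
noncomputable def toPerm (T : IET 𝒜) : Equiv.Perm ℝ where
  toFun := T.toDatum.exchange
  invFun := T.toDatum.flip.exchange
  left_inv := T.toDatum.flip_exchange_exchange T.len_pos
  right_inv x := by
    have h : T.toDatum.flip.flip = T.toDatum := by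
      simp only [Datum.flip, sub_sub_cancel]
    have := T.toDatum.flip.flip_exchange_exchange T.len_pos x
    rwa [h] at this

/-- Keane's condition: no left endpoint of an exchanged interval is mapped by a positive iterate to
a left endpoint other than that of the first interval. -/
def Keane (T : IET 𝒜) : Prop :=
  ∀ m : ℕ, 1 ≤ m → ∀ α β : 𝒜, (T.row 0 β : ℕ) ≠ 0 →
    (T.toPerm ^ m) (T.leftEnd 0 α) ≠ T.leftEnd 0 β

/-- The bounded central condition. -/
def BC [DecidableEq 𝒜] [Nontrivial 𝒜] (T : IET 𝒜) : Prop :=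
  T.Keane ∧ T.OseledetsGeneric ∧ T.InftyComplete ∧
    ∃ n : ℕ → ℕ, StrictMono n ∧
      (∃ (N : ℕ) (K : ℝ), 0 < K ∧ ∀ k α β,
        1 ≤ T.incidence (n k) N α β ∧ T.incidence (n k) N α β ≤ K) ∧
      ∃ V : ℝ, 0 < V ∧ ∀ k, ∀ v ∈ T.centralStable,
        ∑ α, |(T.incidence 0 (n k)).mulVec v α| ≤ V * ∑ α, |v α|

end IET

/-- The Birkhoff sums `S_n f` over an invertible map, `n ∈ ℤ`, with the sign convention which makes
them an additive cocycle: `S_{n + m} f = S_n f + (S_m f) ∘ T^n`. -/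
noncomputable def birkhoffSumInt {X : Type*} (T : Equiv.Perm X) (f : X → ℝ) (n : ℤ) (x : X) : ℝ :=
  if 0 ≤ n then ∑ j ∈ Finset.Ico 0 n, f ((T ^ j) x) else -∑ j ∈ Finset.Ico n 0, f ((T ^ j) x)

end IntervalExchange

/-!
Fix a time `n` of Rauzy-Veech induction. The unit interval is covered by Rokhlin towers over the
intervals `I_α^{(n)}` of `T^{(n)}`; every level of a tower lies in a single exchanged interval of
`T₀`, so that the tower over `I_α^{(n)}` reads a word `towerWord`, and the sum of `w` over this word
is the coordinate `α` of `A^T_{0,n} w` (`incidence_mulVec`). For `n = n_k` and `w` in the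
central-stable space these sums are bounded, uniformly in `k`, by the second part of the bounded
central condition.

Let `x` be any point, on a level of the tower over `I_α^{(n_k)}`. If the orbit of `x` comes back to
the same level of the same tower after crossing `r` towers in all, then the letters read are, up to
order, those of `r` full towers, and the Birkhoff sum is at most `r` times the bound above. The
first part of the bounded central condition makes the towers of `T^{(n_k)}` over
`T^{(n_k + N)}` cross every interval and have height at most `d K`; hence such a return occurs, in
the future and in the past, with `r ≤ 2 d K + 1` (`IsTower.exists_forward`,
`IsTower.exists_backward`). The return takes at least the height of one tower, and the heights tend
to infinity with `k` (`exists_le_length_towerWord`).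

Keane's condition is what keeps the induction defined: in each tower, the left endpoint of
`I_α^{(n)}` reaches that of `I_α` before leaving the tower, so that a tie between the two last
intervals at time `n` would connect two left endpoints of `T₀` (`Keane.len_ne`).
-/

namespace IntervalExchange

/-! ### Words -/

section Concatenation

variable {𝒜 : Type*}

theorem sum_map_flatMap (W : 𝒜 → List 𝒜) (v : 𝒜 → ℝ) (l : List 𝒜) :
    ((l.flatMap W).map v).sum = (l.map fun b => ((W b).map v).sum).sum := by
  induction l with
  | nil => simp
  | cons a l ih => simp [ih]

theorem le_length_flatMap {W : 𝒜 → List 𝒜} {c : ℕ} (hc : ∀ α, c ≤ (W α).length) (l : List 𝒜) :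
    l.length * c ≤ (l.flatMap W).length := by
  induction l with
  | nil => simp
  | cons a l ih =>
    simp only [List.length_cons, List.flatMap_cons, List.length_append]
    linarith [hc a]

/-- A word made of at most `M` full towers has a Birkhoff sum bounded by `M` times the bound for
one tower. -/
theorem abs_sum_map_le {W : 𝒜 → List 𝒜} {w : 𝒜 → ℝ} {D M : ℝ}
    (hD : ∀ α, |((W α).map w).sum| ≤ D) {l u : List 𝒜} (h : l.Perm (u.flatMap W))
    (hu : (u.length : ℝ) ≤ M) (hD0 : 0 ≤ D) : |(l.map w).sum| ≤ M * D := by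
  rw [(h.map w).sum_eq, sum_map_flatMap]
  refine le_trans ?_ (mul_le_mul_of_nonneg_right hu hD0)
  clear h hu
  induction u with
  | nil => simp
  | cons a u ih =>
    rw [List.map_cons, List.sum_cons, List.length_cons]
    push_cast
    refine (abs_add_le _ _).trans ?_
    linarith [hD a]

end Concatenation

/-! ### Itineraries and towers -/

namespace Datum

section Towers

variable {𝒜 : Type*} [Fintype 𝒜]

/-- `R.IsItinerary l y z`: the orbit of `y` under the exchange `R` visits successively the intervals
labelled by the letters of `l`, and then arrives at `z`. -/
def IsItinerary (R : Datum 𝒜) : List 𝒜 → ℝ → ℝ → Prop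
  | [], y, z => y = z
  | a :: l, y, z => y ∈ R.interval 0 a ∧ IsItinerary R l (R.exchange y) z

theorem isItinerary_append {R : Datum 𝒜} {l l' : List 𝒜} {y z : ℝ} :
    R.IsItinerary (l ++ l') y z ↔ ∃ u, R.IsItinerary l y u ∧ R.IsItinerary l' u z := by
  induction l generalizing y with
  | nil => simp [IsItinerary]
  | cons a l ih => simp [IsItinerary, ih, and_assoc]

theorem IsItinerary.append {R : Datum 𝒜} {l l' : List 𝒜} {y u z : ℝ}
    (h : R.IsItinerary l y u) (h' : R.IsItinerary l' u z) : R.IsItinerary (l ++ l') y z :=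
  isItinerary_append.2 ⟨u, h, h'⟩

theorem IsItinerary.iterate_eq {R : Datum 𝒜} {l : List 𝒜} {y z : ℝ}
    (h : R.IsItinerary l y z) : R.exchange^[l.length] y = z := by
  induction l generalizing y with
  | nil => exact h
  | cons a l ih => simpa using ih h.2

theorem IsItinerary.of_append {R : Datum 𝒜} {l l' : List 𝒜} {y u z : ℝ}
    (h : R.IsItinerary (l ++ l') y z) (h' : R.IsItinerary l y u) : R.IsItinerary l' u z := by
  obtain ⟨v, h1, h2⟩ := isItinerary_append.1 h
  rwa [← h'.iterate_eq, h1.iterate_eq]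

theorem IsItinerary.flatMap {R S : Datum 𝒜} {W : 𝒜 → List 𝒜}
    (hW : ∀ α, ∀ y ∈ S.interval 0 α, R.IsItinerary (W α) y (S.exchange y))
    {l : List 𝒜} {y z : ℝ} (h : S.IsItinerary l y z) : R.IsItinerary (l.flatMap W) y z := by
  induction l generalizing y with
  | nil => exact h
  | cons a l ih => exact (hW a y h.1).append (ih h.2)

theorem IsItinerary.sum_iterate {R : Datum 𝒜} (hR : ∀ α, 0 < R.len α) (w : 𝒜 → ℝ)
    {l : List 𝒜} {y z : ℝ} (h : R.IsItinerary l y z) :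
    ∑ j ∈ Finset.range l.length, R.piecewiseConst w (R.exchange^[j] y) = (l.map w).sum := by
  induction l generalizing y with
  | nil => simp
  | cons a l ih =>
    rw [List.length_cons, Finset.sum_range_succ']
    simp only [Function.iterate_succ_apply, Function.iterate_zero, id, ih h.2,
      R.piecewiseConst_of_mem hR w h.1, List.map_cons, List.sum_cons, add_comm]

theorem leftEnd_mem (R : Datum 𝒜) (hR : ∀ α, 0 < R.len α) (α : 𝒜) :
    R.leftEnd 0 α ∈ R.interval 0 α :=
  ⟨le_rfl, by linarith [hR α]⟩

theorem exchange_mem_interval_one (R : Datum 𝒜) (hR : ∀ α, 0 < R.len α) {α : 𝒜} {y : ℝ}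
    (hy : y ∈ R.interval 0 α) : R.exchange y ∈ R.interval 1 α := by
  rw [R.exchange_of_mem hR hy]
  obtain ⟨h1, h2⟩ := hy
  constructor <;> linarith

theorem exists_exchange_mem (R : Datum 𝒜) (hR : ∀ α, 0 < R.len α) {α : 𝒜} {y : ℝ}
    (hy : y ∈ R.interval 0 α) : ∃ β, R.exchange y ∈ R.interval 0 β :=
  (R.exists_mem_interval_iff hR 0 _).2
    ((R.exists_mem_interval_iff hR 1 _).1 ⟨α, R.exchange_mem_interval_one hR hy⟩)

theorem exists_exchange_eq (R : Datum 𝒜) (hR : ∀ α, 0 < R.len α) {α : 𝒜} {y : ℝ}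
    (hy : y ∈ R.interval 0 α) : ∃ β, ∃ u ∈ R.interval 0 β, R.exchange u = y := by
  obtain ⟨β, h1, h2⟩ := (R.exists_mem_interval_iff hR 1 _).2
    ((R.exists_mem_interval_iff hR 0 _).1 ⟨α, hy⟩)
  have hu : y - (R.leftEnd 1 β - R.leftEnd 0 β) ∈ R.interval 0 β := by
    constructor <;> linarith
  exact ⟨β, _, hu, by rw [R.exchange_of_mem hR hu]; ring⟩

/-- The domain of `R` is made of Rokhlin towers over the intervals of `S`, where `W α` lists the
intervals of `R` that contain the successive levels of the tower over `I_α`. The fields say that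
the points of `I_α` follow `W α` and then return as prescribed by `S`, that every point lies on a
level of some tower, and that the left endpoint of the interval `α` of `R` lies in the orbit of that
of `S`, on a level of the tower `α`. Disjointness of the levels is not part of the notion. -/
structure IsTower (R S : Datum 𝒜) (W : 𝒜 → List 𝒜) : Prop where
  itinerary : ∀ α, ∀ y ∈ S.interval 0 α, R.IsItinerary (W α) y (S.exchange y)
  cover : ∀ α, ∀ x ∈ R.interval 0 α, ∃ β, ∃ y ∈ S.interval 0 β, ∃ l₁ l₂,
    W β = l₁ ++ l₂ ∧ l₂ ≠ [] ∧ R.IsItinerary l₁ y x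
  leftEnd : ∀ α, ∃ l₁ l₂, W α = l₁ ++ l₂ ∧ l₂ ≠ [] ∧
    R.IsItinerary l₁ (S.leftEnd 0 α) (R.leftEnd 0 α)

theorem IsTower.refl (R : Datum 𝒜) : IsTower R R fun α => [α] where
  itinerary _ _ hy := ⟨hy, rfl⟩
  cover α x hx := ⟨α, x, hx, [], [α], rfl, by simp, rfl⟩
  leftEnd α := ⟨[], [α], rfl, by simp, rfl⟩

/-- If `y` is on the level `k₁` of a tower of `S` with base point `z`, and `x` is on the level `l₁`
of the tower of `R` with base point `y`, then `x` is on a level of the concatenated tower of `R`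
with base point `z`. -/
theorem IsItinerary.flatMap_append_split {R S : Datum 𝒜} (hS : ∀ α, 0 < S.len α)
    {W : 𝒜 → List 𝒜} (hW : ∀ α, ∀ y ∈ S.interval 0 α, R.IsItinerary (W α) y (S.exchange y))
    {k k₁ k₂ l₁ l₂ : List 𝒜} {z y x z' : ℝ} {β : 𝒜} (hk : k = k₁ ++ k₂) (hk₂ : k₂ ≠ [])
    (h : S.IsItinerary k z z') (h₁ : S.IsItinerary k₁ z y) (hy : y ∈ S.interval 0 β)
    (hl : W β = l₁ ++ l₂) (hl₂ : l₂ ≠ []) (hx : R.IsItinerary l₁ y x) :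
    ∃ j₁ j₂, k.flatMap W = j₁ ++ j₂ ∧ j₂ ≠ [] ∧ R.IsItinerary j₁ z x := by
  subst hk
  obtain _ | ⟨b, k₂⟩ := k₂
  · exact absurd rfl hk₂
  have hb : b = β := S.eq_of_mem_interval hS (h.of_append h₁).1 hy
  subst hb
  exact ⟨k₁.flatMap W ++ l₁, l₂ ++ k₂.flatMap W, by simp [hl], by simp [hl₂],
    (h₁.flatMap hW).append hx⟩

theorem IsTower.trans {R S U : Datum 𝒜} (hS : ∀ α, 0 < S.len α) (hU : ∀ α, 0 < U.len α)
    {W W' : 𝒜 → List 𝒜} (h : IsTower R S W) (h' : IsTower S U W') :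
    IsTower R U fun α => (W' α).flatMap W where
  itinerary α y hy := (h'.itinerary α y hy).flatMap h.itinerary
  cover α x hx := by
    obtain ⟨β, y, hy, l₁, l₂, hl, hl₂, hyx⟩ := h.cover α x hx
    obtain ⟨γ, z, hz, k₁, k₂, hk, hk₂, hzy⟩ := h'.cover β y hy
    exact ⟨γ, z, hz, IsItinerary.flatMap_append_split hS h.itinerary hk hk₂
      (h'.itinerary γ z hz) hzy hy hl hl₂ hyx⟩
  leftEnd α := by
    obtain ⟨l₁, l₂, hl, hl₂, hyx⟩ := h.leftEnd α
    obtain ⟨k₁, k₂, hk, hk₂, hzy⟩ := h'.leftEnd α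
    exact IsItinerary.flatMap_append_split hS h.itinerary hk hk₂
      (h'.itinerary α _ (U.leftEnd_mem hU α)) hzy (S.leftEnd_mem hS α) hl hl₂ hyx

/-- If the towers of `S` over `U` cross all the intervals of `S`, every point of `R` moves forward
to a point on the same level of the same tower over `S`, and the letters it reads are those of a
controlled number of full towers. -/
theorem IsTower.exists_forward {R S U : Datum 𝒜} (hS : ∀ α, 0 < S.len α)
    (hU : ∀ α, 0 < U.len α) {W W' : 𝒜 → List 𝒜} (h : IsTower R S W) (h' : IsTower S U W')
    (hfull : ∀ α γ, γ ∈ W' α) {B : ℝ} (hB : ∀ α, ((W' α).length : ℝ) ≤ B) {δ : 𝒜} {x : ℝ}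
    (hx : x ∈ R.interval 0 δ) :
    ∃ l u z, R.IsItinerary l x z ∧ l.Perm (u.flatMap W) ∧ u ≠ [] ∧
      (u.length : ℝ) ≤ 2 * B + 1 := by
  obtain ⟨α, y, hy, l₁, l₂, hl, -, hyx⟩ := h.cover δ x hx
  have hx₂ : R.IsItinerary l₂ x (S.exchange y) := by
    have := h.itinerary α y hy
    rw [hl] at this
    exact this.of_append hyx
  obtain ⟨β, hβ⟩ := S.exists_exchange_mem hS hy
  obtain ⟨γ, u, hu, k₁, k₂, hk, -, huy⟩ := h'.cover β _ hβ
  have hk₂ : S.IsItinerary k₂ (S.exchange y) (U.exchange u) := by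
    have := h'.itinerary γ u hu
    rw [hk] at this
    exact this.of_append huy
  obtain ⟨κ, hκ⟩ := U.exists_exchange_mem hU hu
  obtain ⟨a₁, a₂, ha⟩ := List.append_of_mem (hfull κ α)
  have hκ' := h'.itinerary κ _ hκ
  rw [ha] at hκ'
  obtain ⟨y', h1, hy', -⟩ := isItinerary_append.1 hκ'
  have hW := h.itinerary α y' hy'
  rw [hl] at hW
  obtain ⟨x', hx', -⟩ := isItinerary_append.1 hW
  refine ⟨l₂ ++ ((k₂ ++ a₁).flatMap W ++ l₁), α :: (k₂ ++ a₁), x',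
    hx₂.append (((hk₂.append h1).flatMap h.itinerary).append hx'), ?_, by simp, ?_⟩
  · rw [List.flatMap_cons, hl, ← List.append_assoc]
    refine List.perm_append_comm.trans ?_
    rw [List.append_assoc]
  · have e1 := hB γ
    have e2 := hB κ
    rw [hk] at e1
    rw [ha] at e2
    simp only [List.length_append, List.length_cons] at e1 e2 ⊢
    push_cast at e1 e2 ⊢
    have : (0 : ℝ) ≤ k₁.length := by positivity
    have : (0 : ℝ) ≤ a₂.length := by positivity
    linarith

/-- The counterpart of `IsTower.exists_forward` for the backward orbit. -/
theorem IsTower.exists_backward {R S U : Datum 𝒜}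
    (hU : ∀ α, 0 < U.len α) {W W' : 𝒜 → List 𝒜} (h : IsTower R S W) (h' : IsTower S U W')
    (hfull : ∀ α γ, γ ∈ W' α) {B : ℝ} (hB : ∀ α, ((W' α).length : ℝ) ≤ B) {δ : 𝒜} {x : ℝ}
    (hx : x ∈ R.interval 0 δ) :
    ∃ l u z, R.IsItinerary l z x ∧ l.Perm (u.flatMap W) ∧ u ≠ [] ∧
      (u.length : ℝ) ≤ 2 * B + 1 := by
  obtain ⟨α, y, hy, l₁, l₂, hl, -, hyx⟩ := h.cover δ x hx
  obtain ⟨γ, u, hu, k₁, k₂, hk, -, huy⟩ := h'.cover α y hy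
  obtain ⟨κ, v, hv, rfl⟩ := U.exists_exchange_eq hU hu
  obtain ⟨a₁, a₂, ha⟩ := List.append_of_mem (hfull κ α)
  have hκ' := h'.itinerary κ v hv
  rw [ha] at hκ'
  obtain ⟨y', -, hy', h2⟩ := isItinerary_append.1 hκ'
  have hW := h.itinerary α y' hy'
  rw [hl] at hW
  obtain ⟨x', -, hx'⟩ := isItinerary_append.1 hW
  refine ⟨l₂ ++ ((a₂ ++ k₁).flatMap W ++ l₁), α :: (a₂ ++ k₁), x',
    hx'.append (((h2.append huy).flatMap h.itinerary).append hyx), ?_, by simp, ?_⟩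
  · rw [List.flatMap_cons, hl, ← List.append_assoc]
    refine List.perm_append_comm.trans ?_
    rw [List.append_assoc]
  · have e1 := hB γ
    have e2 := hB κ
    rw [hk] at e1
    rw [ha] at e2
    simp only [List.length_append, List.length_cons] at e1 e2 ⊢
    push_cast at e1 e2 ⊢
    have : (0 : ℝ) ≤ k₂.length := by positivity
    have : (0 : ℝ) ≤ a₁.length := by positivity
    linarith

end Towers

/-! ### One step of Rauzy-Veech induction -/

section LastSymbol

variable {𝒜 : Type*} [Fintype 𝒜] [Nontrivial 𝒜]

theorem row_lastSymbol (S : Datum 𝒜) (ε : Fin 2) :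
    (S.row ε (S.lastSymbol ε) : ℕ) = Fintype.card 𝒜 - 1 := by
  simp [lastSymbol]

theorem len_loser_lt (S : Datum 𝒜) (h : S.len (S.lastSymbol 0) ≠ S.len (S.lastSymbol 1)) :
    S.len S.loser < S.len S.winner := by
  unfold loser winner type
  split_ifs with h1
  · exact h1
  · exact lt_of_le_of_ne (not_lt.1 h1) h

theorem row_lt_of_ne_lastSymbol (S : Datum 𝒜) (ε : Fin 2) {α : 𝒜} (h : α ≠ S.lastSymbol ε) :
    (S.row ε α : ℕ) < Fintype.card 𝒜 - 1 := by
  have h1 : (S.row ε α : ℕ) ≠ S.row ε (S.lastSymbol ε) := fun e =>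
    h ((S.row ε).injective (Fin.ext e))
  rw [row_lastSymbol] at h1
  have := (S.row ε α).2
  omega

end LastSymbol

section Step

variable {𝒜 : Type*} [Fintype 𝒜] [DecidableEq 𝒜] [Nontrivial 𝒜]

theorem leftEnd_lastSymbol (S : Datum 𝒜) (ε : Fin 2) :
    S.leftEnd ε (S.lastSymbol ε) + S.len (S.lastSymbol ε) = ∑ α, S.len α := by
  unfold leftEnd
  rw [add_comm, ← Finset.sum_insert (by simp)]
  refine Finset.sum_congr ?_ fun _ _ => rfl
  ext β
  simp only [Finset.mem_insert, Finset.mem_filter, Finset.mem_univ, true_and, iff_true]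
  by_cases h : β = S.lastSymbol ε
  · exact Or.inl h
  · have := S.row_lt_of_ne_lastSymbol ε h
    rw [← S.row_lastSymbol ε] at this
    exact Or.inr this

theorem rauzyVeech_len (S : Datum 𝒜) (α : 𝒜) :
    S.rauzyVeech.len α = S.len α - if α = S.winner then S.len S.loser else 0 := by
  by_cases h : α = S.winner
  · subst h; simp [rauzyVeech]
  · simp [rauzyVeech, h]

theorem rauzyVeech_len_of_ne (S : Datum 𝒜) {α : 𝒜} (h : α ≠ S.winner) :
    S.rauzyVeech.len α = S.len α := by
  simp [rauzyVeech, h]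

theorem rauzyVeech_len_winner (S : Datum 𝒜) :
    S.rauzyVeech.len S.winner = S.len S.winner - S.len S.loser := by
  simp [rauzyVeech]

theorem rauzyVeech_row_type (S : Datum 𝒜) : S.rauzyVeech.row S.type = S.row S.type := by
  have : S.type ≠ 1 - S.type := by
    generalize S.type = ε
    fin_cases ε <;> simp
  simp [rauzyVeech, this]

theorem moveLast_val {d : ℕ} (p r : Fin d) : (moveLast p r : ℕ) =
    if r ≤ p then (r : ℕ) else if (r : ℕ) + 1 < d then r + 1 else p + 1 := by
  simp only [moveLast, Equiv.coe_fn_mk]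
  split_ifs <;> simp

theorem rauzyVeech_row_one_sub_type (S : Datum 𝒜) (α : 𝒜) :
    (S.rauzyVeech.row (1 - S.type) α : ℕ) =
      if (S.row (1 - S.type) α : ℕ) ≤ S.row (1 - S.type) S.winner then
        (S.row (1 - S.type) α : ℕ)
      else if (S.row (1 - S.type) α : ℕ) + 1 < Fintype.card 𝒜 then S.row (1 - S.type) α + 1
      else S.row (1 - S.type) S.winner + 1 := by
  simp only [rauzyVeech, Function.update_self, Equiv.trans_apply, moveLast_val, Fin.le_def]

theorem rauzyVeech_row_eq_zero (S : Datum 𝒜) (ε : Fin 2) (α : 𝒜) :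
    (S.rauzyVeech.row ε α : ℕ) = 0 ↔ (S.row ε α : ℕ) = 0 := by
  have hε : ε = S.type ∨ ε = 1 - S.type := by
    generalize S.type = δ
    fin_cases δ <;> fin_cases ε <;> simp
  rcases hε with rfl | rfl
  · rw [rauzyVeech_row_type]
  · rw [rauzyVeech_row_one_sub_type]
    split_ifs <;> (try rw [false_iff]) <;> omega

theorem leftEnd_rauzyVeech_type (S : Datum 𝒜) (α : 𝒜) :
    S.rauzyVeech.leftEnd S.type α = S.leftEnd S.type α := by
  unfold leftEnd
  rw [rauzyVeech_row_type]
  refine Finset.sum_congr rfl fun β hβ => S.rauzyVeech_len_of_ne ?_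
  rintro rfl
  have h1 := S.row_lastSymbol S.type
  have h2 := (S.row S.type α).2
  simp only [Finset.mem_filter, Finset.mem_univ, true_and, Fin.lt_def, winner] at hβ
  omega

theorem leftEnd_rauzyVeech_loser (S : Datum 𝒜) (hne : S.winner ≠ S.loser) :
    S.rauzyVeech.leftEnd (1 - S.type) S.loser =
      S.leftEnd (1 - S.type) S.winner + S.len S.winner - S.len S.loser := by
  have ha := S.row_lt_of_ne_lastSymbol (1 - S.type) hne
  have hb : (S.row (1 - S.type) S.loser : ℕ) = _ := S.row_lastSymbol (1 - S.type)
  have hset : (Finset.univ.filter fun β =>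
      S.rauzyVeech.row (1 - S.type) β < S.rauzyVeech.row (1 - S.type) S.loser) =
      insert S.winner (Finset.univ.filter fun β =>
        S.row (1 - S.type) β < S.row (1 - S.type) S.winner) := by
    ext β
    have h2 := (S.row (1 - S.type) β).2
    have h3 : β = S.winner ↔ (S.row (1 - S.type) β : ℕ) = S.row (1 - S.type) S.winner := by
      rw [← Fin.ext_iff, (S.row (1 - S.type)).apply_eq_iff_eq]
    simp only [Finset.mem_insert, Finset.mem_filter, Finset.mem_univ, true_and, Fin.lt_def, h3,
      rauzyVeech_row_one_sub_type]
    split_ifs <;> omega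
  unfold leftEnd
  rw [hset, Finset.sum_insert (by simp), rauzyVeech_len_winner]
  have : ∑ β with S.row (1 - S.type) β < S.row (1 - S.type) S.winner, S.rauzyVeech.len β =
      ∑ β with S.row (1 - S.type) β < S.row (1 - S.type) S.winner, S.len β := by
    refine Finset.sum_congr rfl fun β hβ => S.rauzyVeech_len_of_ne ?_
    rintro rfl
    simp at hβ
  rw [this]
  ring

theorem leftEnd_rauzyVeech_of_ne (S : Datum 𝒜) (hne : S.winner ≠ S.loser) {α : 𝒜}
    (hα : α ≠ S.loser) :
    S.rauzyVeech.leftEnd (1 - S.type) α = S.leftEnd (1 - S.type) α := by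
  have ha := S.row_lt_of_ne_lastSymbol (1 - S.type) hne
  have hα' := S.row_lt_of_ne_lastSymbol (1 - S.type) hα
  have hb : (S.row (1 - S.type) S.loser : ℕ) = _ := S.row_lastSymbol (1 - S.type)
  unfold leftEnd
  by_cases hle : (S.row (1 - S.type) α : ℕ) ≤ S.row (1 - S.type) S.winner
  · have hset : (Finset.univ.filter fun β =>
        S.rauzyVeech.row (1 - S.type) β < S.rauzyVeech.row (1 - S.type) α) =
        Finset.univ.filter fun β => S.row (1 - S.type) β < S.row (1 - S.type) α := by
      ext β
      simp only [Finset.mem_filter, Finset.mem_univ, true_and, Fin.lt_def,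
        rauzyVeech_row_one_sub_type]
      split_ifs <;> omega
    rw [hset]
    refine Finset.sum_congr rfl fun β hβ => S.rauzyVeech_len_of_ne ?_
    rintro rfl
    simp only [Finset.mem_filter, Finset.mem_univ, true_and, Fin.lt_def] at hβ
    omega
  · have hset : (Finset.univ.filter fun β =>
        S.rauzyVeech.row (1 - S.type) β < S.rauzyVeech.row (1 - S.type) α) =
        insert S.loser (Finset.univ.filter fun β =>
          S.row (1 - S.type) β < S.row (1 - S.type) α) := by
      ext β
      have h2 := (S.row (1 - S.type) β).2
      have h3 : β = S.loser ↔ (S.row (1 - S.type) β : ℕ) = S.row (1 - S.type) S.loser := by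
        rw [← Fin.ext_iff, (S.row (1 - S.type)).apply_eq_iff_eq]
      simp only [Finset.mem_insert, Finset.mem_filter, Finset.mem_univ, true_and, Fin.lt_def, h3,
        rauzyVeech_row_one_sub_type]
      split_ifs <;> omega
    -- The loser now precedes `α`, which compensates for the shortening of the winner.
    rw [hset, Finset.sum_insert (by
      simp only [Finset.mem_filter, Finset.mem_univ, true_and, Fin.lt_def]; omega),
      S.rauzyVeech_len_of_ne hne.symm]
    simp only [rauzyVeech_len, Finset.sum_sub_distrib, Finset.sum_ite_eq']
    rw [if_pos (by
      simp only [Finset.mem_filter, Finset.mem_univ, true_and, Fin.lt_def]; omega)]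
    ring

theorem rauzyVeech_len_pos (S : Datum 𝒜) (hS : ∀ α, 0 < S.len α)
    (h : S.len (S.lastSymbol 0) ≠ S.len (S.lastSymbol 1)) (α : 𝒜) : 0 < S.rauzyVeech.len α := by
  by_cases hα : α = S.winner
  · rw [hα, rauzyVeech_len_winner]
    exact sub_pos.2 (S.len_loser_lt h)
  · rw [S.rauzyVeech_len_of_ne hα]
    exact hS α

/-- The words describing the domain of `S` as towers over the intervals of `S.rauzyVeech`. The loser
is the only symbol whose tower has two levels; the type decides their order. -/
noncomputable def stepWord (S : Datum 𝒜) (α : 𝒜) : List 𝒜 :=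
  if α = S.loser then if S.type = 0 then [S.loser, S.winner] else [S.winner, S.loser] else [α]

theorem isTower_rauzyVeech (S : Datum 𝒜) (hS : ∀ α, 0 < S.len α)
    (h : S.len (S.lastSymbol 0) ≠ S.len (S.lastSymbol 1)) :
    IsTower S S.rauzyVeech S.stepWord := by
  have hlt := S.len_loser_lt h
  have hne : S.winner ≠ S.loser := fun e => hlt.ne (congrArg S.len e.symm)
  have hS' := S.rauzyVeech_len_pos hS h
  have hb := hS S.loser
  have eT := S.leftEnd_rauzyVeech_type
  have eL := S.leftEnd_rauzyVeech_loser hne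
  have eN := fun {α} => S.leftEnd_rauzyVeech_of_ne hne (α := α)
  have w0 : S.leftEnd S.type S.winner + S.len S.winner = _ := S.leftEnd_lastSymbol S.type
  have w1 : S.leftEnd (1 - S.type) S.loser + S.len S.loser = _ :=
    S.leftEnd_lastSymbol (1 - S.type)
  have lw := S.rauzyVeech_len_winner
  have lN := fun {α} => S.rauzyVeech_len_of_ne (α := α)
  have lL := S.rauzyVeech_len_of_ne hne.symm
  have hwin := fun {x} => S.exchange_of_mem hS (α := S.winner) (x := x)
  have hlos := fun {x} => S.exchange_of_mem hS (α := S.loser) (x := x)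
  have htype : S.type = 0 ∨ S.type = 1 := by
    generalize S.type = ε
    fin_cases ε <;> simp
  rcases htype with ht | ht
  -- Type 0: `S` maps the interval of the loser, which is unchanged, onto the end cut off from the
  -- interval of the winner.
  · have hw : S.stepWord S.loser = [S.loser, S.winner] := by simp [stepWord, ht]
    have hw' : ∀ α ≠ S.loser, S.stepWord α = [α] := fun α hα => by simp [stepWord, hα]
    rw [ht] at eT eL eN w0 w1
    simp only [sub_zero] at eL eN w1
    refine ⟨fun α y hy => ?_, fun α x hx => ?_, fun α => ?_⟩
    · rw [S.rauzyVeech.exchange_of_mem hS' hy]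
      obtain ⟨h1, h2⟩ := hy
      rw [eT] at h1 h2 ⊢
      by_cases hα : α = S.loser
      · subst hα
        rw [hw, eL]
        rw [lL] at h2
        have m1 : y ∈ S.interval 0 S.loser := ⟨h1, h2⟩
        have m2 : S.exchange y ∈ S.interval 0 S.winner := by
          rw [hlos m1]
          constructor <;> linarith
        refine ⟨m1, m2, ?_⟩
        change S.exchange (S.exchange y) = _
        rw [hwin m2, hlos m1]
        linarith
      · rw [hw' α hα, eN hα]
        have m1 : y ∈ S.interval 0 α := by
          refine ⟨h1, ?_⟩
          rw [rauzyVeech_len] at h2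
          split_ifs at h2 <;> linarith
        exact ⟨m1, S.exchange_of_mem hS m1⟩
    · have hx1 := hx.1
      have hx2 := hx.2
      by_cases hα : α = S.winner ∧ S.leftEnd 0 S.winner + (S.len S.winner - S.len S.loser) ≤ x
      · obtain ⟨rfl, hα⟩ := hα
        have m : x - (S.leftEnd 1 S.loser - S.leftEnd 0 S.loser) ∈ S.interval 0 S.loser := by
          constructor <;> linarith
        refine ⟨S.loser, _, ?_, [S.loser], [S.winner], hw, by simp, m, ?_⟩
        · exact ⟨(eT _).le.trans m.1, by rw [eT, lL]; exact m.2⟩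
        · change S.exchange _ = x
          rw [hlos m]
          ring
      · refine ⟨α, x, ⟨?_, ?_⟩, [], S.stepWord α, rfl, ?_, rfl⟩
        · rwa [eT]
        · rw [eT]
          by_cases hαw : α = S.winner
          · subst hαw
            rw [lw]
            exact not_le.1 fun e => hα ⟨rfl, e⟩
          · rwa [lN hαw]
        · unfold stepWord
          split_ifs <;> simp
    · refine ⟨[], S.stepWord α, rfl, ?_, eT α⟩
      unfold stepWord
      split_ifs <;> simp
  -- Type 1: the new interval of the loser is the end cut off from that of the winner, which `S`
  -- maps onto the old interval of the loser, now outside the domain.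
  · have hw : S.stepWord S.loser = [S.winner, S.loser] := by simp [stepWord, ht]
    have hw' : ∀ α ≠ S.loser, S.stepWord α = [α] := fun α hα => by simp [stepWord, hα]
    rw [ht] at eT eL eN w0 w1
    simp only [sub_self] at eL eN w1
    refine ⟨fun α y hy => ?_, fun α x hx => ?_, fun α => ?_⟩
    · rw [S.rauzyVeech.exchange_of_mem hS' hy]
      obtain ⟨h1, h2⟩ := hy
      rw [eT]
      by_cases hα : α = S.loser
      · subst hα
        rw [hw, eL]
        rw [eL] at h1 h2
        rw [lL] at h2
        have m1 : y ∈ S.interval 0 S.winner := by constructor <;> linarith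
        have m2 : S.exchange y ∈ S.interval 0 S.loser := by
          rw [hwin m1]
          constructor <;> linarith
        refine ⟨m1, m2, ?_⟩
        change S.exchange (S.exchange y) = _
        rw [hlos m2, hwin m1]
        linarith
      · rw [eN hα] at h1 h2 ⊢
        rw [hw' α hα]
        have m1 : y ∈ S.interval 0 α := by
          refine ⟨h1, ?_⟩
          rw [rauzyVeech_len] at h2
          split_ifs at h2 <;> linarith
        exact ⟨m1, S.exchange_of_mem hS m1⟩
    · have hx1 := hx.1
      have hx2 := hx.2
      by_cases hαl : α = S.loser
      · subst hαl
        have m : x - (S.leftEnd 1 S.winner - S.leftEnd 0 S.winner) ∈ S.interval 0 S.winner := by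
          constructor <;> linarith
        refine ⟨S.loser, _, ⟨?_, ?_⟩, [S.winner], [S.loser], hw, by simp, m, ?_⟩
        · rw [eL]; linarith
        · rw [eL, lL]; linarith
        · change S.exchange _ = x
          rw [hwin m]
          ring
      · by_cases hα : α = S.winner ∧ S.leftEnd 0 S.winner + (S.len S.winner - S.len S.loser) ≤ x
        · obtain ⟨rfl, hα⟩ := hα
          refine ⟨S.loser, x, ⟨?_, ?_⟩, [], _, hw, by simp, rfl⟩
          · rw [eL]; linarith
          · rw [eL, lL]; linarith
        · refine ⟨α, x, ⟨?_, ?_⟩, [], [α], hw' α hαl, by simp, rfl⟩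
          · rwa [eN hαl]
          · rw [eN hαl]
            by_cases hαw : α = S.winner
            · subst hαw
              rw [lw]
              exact not_le.1 fun e => hα ⟨rfl, e⟩
            · rwa [lN hαw]
    · by_cases hαl : α = S.loser
      · subst hαl
        have m : S.rauzyVeech.leftEnd 0 S.loser ∈ S.interval 0 S.winner := by
          rw [eL]
          constructor <;> linarith
        refine ⟨[S.winner], [S.loser], hw, by simp, m, ?_⟩
        change S.exchange _ = _
        rw [hwin m, eL]
        linarith
      · exact ⟨[], [α], hw' α hαl, by simp, eN hαl⟩

theorem rauzyMatrix_transpose_mulVec (S : Datum 𝒜) (v : 𝒜 → ℝ) (α : 𝒜) :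
    S.rauzyMatrix.transpose.mulVec v α = ((S.stepWord α).map v).sum := by
  have h : S.rauzyMatrix.transpose.mulVec v α =
      v α + if α = S.loser then v S.winner else 0 := by
    simp only [rauzyMatrix, Matrix.transpose_add, Matrix.transpose_one, Matrix.transpose_single,
      Matrix.add_mulVec, Matrix.one_mulVec, Pi.add_apply, add_right_inj]
    by_cases hα : α = S.loser
    · subst hα; simp [Matrix.mulVec, dotProduct, Matrix.single_apply]
    · simp [Matrix.mulVec, dotProduct, hα, Ne.symm hα]
  rw [h]
  unfold stepWord
  split_ifs with h1 h2
  · simp [h1]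
  · simp [h1, add_comm]
  · simp

/-! ### The orbit of Rauzy-Veech induction -/

/-- The words describing the domain of the datum at time `m` as towers over the intervals of the
datum at time `m + k`. -/
noncomputable def towerWord (T : Datum 𝒜) (m : ℕ) : ℕ → 𝒜 → List 𝒜
  | 0 => fun α => [α]
  | k + 1 => fun α => (stepWord (rauzyVeech^[m + k] T) α).flatMap (towerWord T m k)

theorem incidence_mulVec (T : Datum 𝒜) (m k : ℕ) (v : 𝒜 → ℝ) (α : 𝒜) :
    (T.incidence m k).mulVec v α = ((T.towerWord m k α).map v).sum := by
  induction k generalizing α with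
  | zero => simp [incidence, cocycleProd, towerWord]
  | succ k ih =>
    have : T.incidence m (k + 1) =
        (rauzyMatrix (rauzyVeech^[m + k] T)).transpose * T.incidence m k := rfl
    rw [this, ← Matrix.mulVec_mulVec, rauzyMatrix_transpose_mulVec, towerWord, sum_map_flatMap,
      funext ih]

theorem towerWord_add (T : Datum 𝒜) (m k : ℕ) (α : 𝒜) :
    T.towerWord 0 (m + k) α = (T.towerWord m k α).flatMap (T.towerWord 0 m) := by
  induction k generalizing α with
  | zero => simp [towerWord]
  | succ k ih =>
    rw [← add_assoc, towerWord, towerWord, List.flatMap_assoc, zero_add, funext ih]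

theorem towerWord_ne_nil (T : Datum 𝒜) (m k : ℕ) (α : 𝒜) : T.towerWord m k α ≠ [] := by
  induction k generalizing α with
  | zero => simp [towerWord]
  | succ k ih =>
    simp only [towerWord, stepWord]
    split_ifs <;> simp [ih]

theorem isTower_towerWord (T : Datum 𝒜) (hpos : ∀ n α, 0 < (rauzyVeech^[n] T).len α)
    (hne : ∀ n, (rauzyVeech^[n] T).len ((rauzyVeech^[n] T).lastSymbol 0) ≠
      (rauzyVeech^[n] T).len ((rauzyVeech^[n] T).lastSymbol 1)) (m k : ℕ) :
    IsTower (rauzyVeech^[m] T) (rauzyVeech^[m + k] T) (T.towerWord m k) := by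
  induction k with
  | zero => exact IsTower.refl _
  | succ k ih =>
    have hp := hpos (m + k + 1)
    rw [← add_assoc]
    rw [Function.iterate_succ_apply'] at hp ⊢
    exact ih.trans (hpos _) hp (isTower_rauzyVeech _ (hpos _) (hne _))

end Step

end Datum

/-! ### Birkhoff sums, and the role of Keane's condition -/

namespace IET

open Datum

variable {𝒜 : Type*} [Fintype 𝒜]

theorem iterate_exchange (T : IET 𝒜) (n : ℕ) (x : ℝ) :
    T.toDatum.exchange^[n] x = (T.toPerm ^ n) x := by
  rw [Equiv.Perm.coe_pow]
  rfl

theorem birkhoffSumInt_of_isItinerary (T : IET 𝒜) (w : 𝒜 → ℝ) {l : List 𝒜} {y z : ℝ}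
    (h : T.IsItinerary l y z) :
    birkhoffSumInt T.toPerm (T.piecewiseConst w) l.length y = (l.map w).sum := by
  rw [← h.sum_iterate T.len_pos w, birkhoffSumInt, if_pos (by positivity)]
  refine Finset.sum_nbij' Int.toNat (fun j => (j : ℤ)) ?_ ?_ ?_ ?_ ?_
  · intro j hj
    simp only [Finset.mem_Ico, Finset.mem_range] at hj ⊢
    omega
  · intro j hj
    simp only [Finset.mem_Ico, Finset.mem_range] at hj ⊢
    omega
  · intro j hj
    simp only [Finset.mem_Ico] at hj
    omega
  · intro j _
    simp
  · intro j hj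
    simp only [Finset.mem_Ico] at hj
    obtain ⟨i, rfl⟩ := Int.eq_ofNat_of_zero_le hj.1
    rw [Int.toNat_natCast, iterate_exchange, zpow_natCast]

theorem birkhoffSumInt_neg_of_isItinerary (T : IET 𝒜) (w : 𝒜 → ℝ) {l : List 𝒜} {y z : ℝ}
    (hl : l ≠ []) (h : T.IsItinerary l y z) :
    birkhoffSumInt T.toPerm (T.piecewiseConst w) (-l.length) z = -(l.map w).sum := by
  have hl' : 0 < l.length := List.length_pos_iff.2 hl
  rw [← h.sum_iterate T.len_pos w, birkhoffSumInt, if_neg (by omega), ← h.iterate_eq]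
  congr 1
  refine Finset.sum_nbij' (fun j => (j + l.length).toNat) (fun j => (j : ℤ) - l.length)
    ?_ ?_ ?_ ?_ ?_
  · intro j hj
    simp only [Finset.mem_Ico, Finset.mem_range] at hj ⊢
    omega
  · intro j hj
    simp only [Finset.mem_Ico, Finset.mem_range] at hj ⊢
    omega
  · intro j hj
    simp only [Finset.mem_Ico] at hj
    omega
  · intro j _
    simp
  · intro j hj
    simp only [Finset.mem_Ico] at hj
    rw [iterate_exchange, iterate_exchange, ← zpow_natCast, ← zpow_natCast,
      ← Equiv.Perm.mul_apply, ← zpow_add, Int.toNat_of_nonneg (by omega)]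

variable [DecidableEq 𝒜] [Nontrivial 𝒜]

/-- Under Keane's condition, a tie between the last two intervals, which would join two left
endpoints by an orbit, cannot occur. -/
theorem Keane.len_ne (T : IET 𝒜) (hT : T.Keane) {S : Datum 𝒜} {W : 𝒜 → List 𝒜}
    (hS : ∀ α, 0 < S.len α) (h : IsTower T.toDatum S W)
    (hrow : ∀ α, (S.row 0 α : ℕ) = 0 ↔ (T.row 0 α : ℕ) = 0) :
    S.len (S.lastSymbol 0) ≠ S.len (S.lastSymbol 1) := by
  intro heq
  obtain ⟨l₁, l₂, hl, hl₂, h1⟩ := h.leftEnd (S.lastSymbol 1)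
  obtain ⟨k₁, -, -, -, h2⟩ := h.leftEnd (S.lastSymbol 0)
  have hm := S.leftEnd_mem hS (S.lastSymbol 1)
  have h3 := h.itinerary _ _ hm
  have e : S.exchange (S.leftEnd 0 (S.lastSymbol 1)) = S.leftEnd 0 (S.lastSymbol 0) := by
    rw [S.exchange_of_mem hS hm]
    linarith [S.leftEnd_lastSymbol 0, S.leftEnd_lastSymbol 1]
  rw [hl, e] at h3
  have h4 := ((h3.of_append h1).append h2).iterate_eq
  rw [iterate_exchange] at h4
  refine hT _ ?_ (S.lastSymbol 1) (S.lastSymbol 0) ?_ h4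
  · have := List.length_pos_iff.2 hl₂
    rw [List.length_append]
    omega
  · rw [ne_eq, ← hrow, row_lastSymbol]
    have := Fintype.one_lt_card (α := 𝒜)
    omega

theorem Keane.orbit (T : IET 𝒜) (hT : T.Keane) (n : ℕ) :
    (∀ α, 0 < (rauzyVeech^[n] T.toDatum).len α) ∧
      (∀ α, ((rauzyVeech^[n] T.toDatum).row 0 α : ℕ) = 0 ↔ (T.row 0 α : ℕ) = 0) ∧
      ∃ W, IsTower T.toDatum (rauzyVeech^[n] T.toDatum) W := by
  induction n with
  | zero => exact ⟨T.len_pos, fun _ => Iff.rfl, _, IsTower.refl _⟩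
  | succ n ih =>
    obtain ⟨h1, h2, W, h3⟩ := ih
    have hne := hT.len_ne T h1 h3 h2
    rw [Function.iterate_succ_apply']
    exact ⟨rauzyVeech_len_pos _ h1 hne, fun α => (rauzyVeech_row_eq_zero _ 0 α).trans (h2 α), _,
      h3.trans h1 (rauzyVeech_len_pos _ h1 hne) (isTower_rauzyVeech _ h1 hne)⟩

theorem Keane.isTower (T : IET 𝒜) (hT : T.Keane) (m k : ℕ) :
    IsTower (rauzyVeech^[m] T.toDatum) (rauzyVeech^[m + k] T.toDatum) (T.towerWord m k) := by
  refine isTower_towerWord _ (fun n => (hT.orbit T n).1) (fun n => ?_) m k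
  obtain ⟨h1, h2, W, h3⟩ := hT.orbit T n
  exact hT.len_ne T h1 h3 h2

end IET

/-! ### Bounded Birkhoff sums along returns to a tower level -/

section Recurrence

open Datum

variable {𝒜 : Type*} [Fintype 𝒜] [DecidableEq 𝒜] [Nontrivial 𝒜]

theorem mem_towerWord_of_incidence_pos (T : Datum 𝒜) {m k : ℕ} {α γ : 𝒜}
    (h : 0 < T.incidence m k α γ) : γ ∈ T.towerWord m k α := by
  by_contra hγ
  have h1 := T.incidence_mulVec m k (Pi.single γ 1) α
  rw [Matrix.mulVec_single_one, Matrix.col_apply, List.sum_eq_zero] at h1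
  · exact h.ne' h1
  · intro r hr
    obtain ⟨b, hb, rfl⟩ := List.mem_map.1 hr
    exact Pi.single_eq_of_ne (fun e : b = γ => hγ (e ▸ hb)) _

theorem length_towerWord (T : Datum 𝒜) (m k : ℕ) (α : 𝒜) :
    ((T.towerWord m k α).length : ℝ) = ∑ γ, T.incidence m k α γ := by
  have h1 := T.incidence_mulVec m k (fun _ => 1) α
  simpa [Matrix.mulVec, dotProduct] using h1.symm

/-- The heights of the towers over the times `n k` tend to infinity: they at least double each
time a positive product of length `N` is traversed. -/
theorem exists_le_length_towerWord (T : Datum 𝒜) {n : ℕ → ℕ} (hn : StrictMono n) {N : ℕ}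
    (hfull : ∀ k α γ, γ ∈ T.towerWord (n k) N α) (c : ℕ) :
    ∃ k, ∀ α, c ≤ (T.towerWord 0 (n k) α).length := by
  induction c with
  | zero => exact ⟨0, fun _ => Nat.zero_le _⟩
  | succ c ih =>
    obtain ⟨k, hk⟩ := ih
    have h1 : ∀ α, c + 1 ≤ (T.towerWord 0 (n k + N) α).length := by
      intro α
      have hpos := List.length_pos_iff.2 (T.towerWord_ne_nil 0 (n k + N) α)
      have h2 : 2 ≤ (T.towerWord (n k) N α).length := by
        obtain ⟨γ, δ, hne⟩ := exists_pair_ne 𝒜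
        have hγ := hfull k α γ
        have hδ := hfull k α δ
        by_contra! hlt
        obtain ⟨b, hb⟩ := List.length_eq_one_iff.1
          (show (T.towerWord (n k) N α).length = 1 by
            have := List.length_pos_of_mem hγ
            omega)
        rw [hb, List.mem_singleton] at hγ hδ
        exact hne (hγ.trans hδ.symm)
      have h3 := le_length_flatMap hk (T.towerWord (n k) N α)
      rw [← towerWord_add] at h3
      have h4 := Nat.mul_le_mul_right c h2
      omega
    have hle : n k + N ≤ n (k + N) := by
      rw [add_comm, add_comm k]
      exact hn.add_le_nat N k
    obtain ⟨j, hj⟩ := Nat.exists_eq_add_of_le hle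
    refine ⟨k + N, fun α => ?_⟩
    rw [hj, towerWord_add]
    have h3 := le_length_flatMap h1 (T.towerWord (n k + N) j α)
    have h4 := Nat.mul_le_mul_right (c + 1)
      (List.length_pos_iff.2 (T.towerWord_ne_nil (n k + N) j α))
    omega

theorem IET.BC.exists_bounded (T : IET 𝒜) (hT : T.BC) (w : 𝒜 → ℝ) (hw : w ∈ T.centralStable)
    (x : ℝ) (hx : x ∈ Set.Ico (0 : ℝ) 1) :
    ∃ C : ℝ, ∀ c : ℕ,
      (∃ m : ℤ, c ≤ m ∧ |birkhoffSumInt T.toPerm (T.piecewiseConst w) m x| ≤ C) ∧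
      ∃ m : ℤ, m ≤ -c ∧ |birkhoffSumInt T.toPerm (T.piecewiseConst w) m x| ≤ C := by
  obtain ⟨hK, -, -, n, hn, ⟨N, K, hKpos, hinc⟩, V, hV, hbound⟩ := hT
  have hpos := fun n => (hK.orbit T n).1
  have hfull : ∀ k α γ, γ ∈ T.towerWord (n k) N α := fun k α γ =>
    mem_towerWord_of_incidence_pos _ (one_pos.trans_le (hinc k α γ).1)
  have hlen : ∀ k α, ((T.towerWord (n k) N α).length : ℝ) ≤ Fintype.card 𝒜 * K := by
    intro k α
    rw [length_towerWord]
    refine (Finset.sum_le_card_nsmul _ _ K fun γ _ => (hinc k α γ).2).trans ?_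
    simp
  have hD : ∀ k α, |((T.towerWord 0 (n k) α).map w).sum| ≤ V * ∑ α, |w α| := by
    intro k α
    rw [← incidence_mulVec]
    exact (Finset.single_le_sum
      (f := fun α => |(T.incidence 0 (n k)).mulVec w α|)
      (fun _ _ => abs_nonneg _) (Finset.mem_univ α)).trans (hbound k w hw)
  have hD0 : 0 ≤ V * ∑ α, |w α| := by positivity
  obtain ⟨δ, hδ⟩ := (T.toDatum.exists_mem_interval_iff T.len_pos 0 x).2 (by
    rw [T.len_sum]; exact hx)
  refine ⟨(2 * (Fintype.card 𝒜 * K) + 1) * (V * ∑ α, |w α|), fun c => ?_⟩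
  obtain ⟨k, hk⟩ := exists_le_length_towerWord T.toDatum hn hfull (c + 1)
  have h1 := hK.isTower T 0 (n k)
  rw [zero_add] at h1
  have h2 := hK.isTower T (n k) N
  -- The word that is read consists of at least one full tower, so it is long.
  have hlong : ∀ l u : List 𝒜, l.Perm (u.flatMap (T.towerWord 0 (n k))) → u ≠ [] →
      c + 1 ≤ l.length := by
    intro l u hl hu
    rw [hl.length_eq]
    have h3 := le_length_flatMap hk u
    have h4 := Nat.mul_le_mul_right (c + 1) (List.length_pos_iff.2 hu)
    omega
  constructor
  · obtain ⟨l, u, z, hz, hl, hu, hu'⟩ :=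
      h1.exists_forward (hpos _) (hpos _) h2 (hfull k) (hlen k) hδ
    have := hlong l u hl hu
    refine ⟨l.length, by omega, ?_⟩
    rw [T.birkhoffSumInt_of_isItinerary w hz]
    exact abs_sum_map_le (hD k) hl hu' hD0
  · obtain ⟨l, u, z, hz, hl, hu, hu'⟩ :=
      h1.exists_backward (hpos _) h2 (hfull k) (hlen k) hδ
    have := hlong l u hl hu
    refine ⟨-l.length, by omega, ?_⟩
    rw [T.birkhoffSumInt_neg_of_isItinerary w (List.length_pos_iff.1 (by omega)) hz, abs_neg]
    exact abs_sum_map_le (hD k) hl hu' hD0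

end Recurrence

end IntervalExchange

theorem corollary4p3 {𝒜 : Type*} [Fintype 𝒜] [DecidableEq 𝒜] [Nontrivial 𝒜]
    (T₀ : IntervalExchange.IET 𝒜) (hT₀ : T₀.BC) (w : 𝒜 → ℝ) (hw : w ∈ T₀.centralStable)
    (x : ℝ) (hx : x ∈ Set.Ico (0 : ℝ) 1) :
    ∃ m : ℤ → ℤ, Tendsto m atTop atTop ∧ Tendsto m atBot atBot ∧
      BddAbove (Set.range fun k : ℤ =>
        |IntervalExchange.birkhoffSumInt T₀.toPerm (T₀.piecewiseConst w) (m k) x|) := by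
  obtain ⟨C, hC⟩ := hT₀.exists_bounded T₀ w hw x hx
  choose p hp hp' using fun c => (hC c).1
  choose q hq hq' using fun c => (hC c).2
  refine ⟨fun k => if 0 ≤ k then p k.toNat else q (-k).toNat, ?_, ?_, C, ?_⟩
  · refine tendsto_atTop_mono' _ ?_ tendsto_id
    filter_upwards [eventually_ge_atTop 0] with k hk
    have := hp k.toNat
    simp only [if_pos hk, id]
    omega
  · refine tendsto_atBot_mono' _ ?_ tendsto_id
    filter_upwards [eventually_lt_atBot 0] with k hk
    have := hq (-k).toNat
    simp only [if_neg (not_le.2 hk), id]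
    omega
  · rintro _ ⟨k, rfl⟩
    dsimp only
    split_ifs
    · exact hp' _
    · exact hq' _
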